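/- Let $\mathcal H$ be a complex separable Hilbert space and $n\in\mathbb N\cup\{\infty\}$. Let $\mathcal S_n(\mathcal H)$ be the set of linear operators $T:\mathscr D(T)\subset\mathcal H\to\mathcal H$ that are densely defined, closed, symmetric ($\langle Tx,y\rangle=\langle x,Ty\rangle$ for $x,y\in\mathscr D(T)$), simple ($\bigcap_{\Im\lambda\ne0}\mathrm{Rng}(T-\lambda I)=\{0\}$), and satisfy $\dim\mathrm{Rng}(T-iI)^\perp=\dim\mathrm{Rng}(T+iI)^\perp=n$. Let $\mathcal K$ be any complex separable Hilbert space of dimension $n$. A *model* for $T$ is a function $\Gamma:\mathbb C\setminus\mathbb R\to\mathcal B(\mathcal K,\mathcal H)$ such that 1. $\Gamma$ is co-analytic, i.e. $\lambda\mapsto\Gamma(\overline\lambda)$ is analytic on $\mathbb C\setminus\mathbb R$; 2. for every $\lambda\in\mathbb C\setminus\mathbb R$, $\Gamma(\lambda)$ is a bounded invertible operator from $\mathcal K$ onto $\mathrm{Rng}(T-\lambda I)^\perp$; 3. $\Gamma(z)^*\Gamma(\lambda):\mathcal K\to\mathcal K$ is invertible whenever $z,\lambda\in\mathbb C_+$ or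 $z,\lambda\in\mathbb C_-$; 4. the closed linear span of $\bigcup_{\Im\lambda\ne0}\mathrm{Rng}\,\Gamma(\lambda)$ is $\mathcal H$. **Proposition.** Every $T\in\mathcal S_n(\mathcal H)$ has a model $\Gamma:\mathbb C\setminus\mathbb R\to\mathcal B(\mathcal K,\mathcal H)$. Moreover, $T$ has a self-adjoint extension in $\mathcal H$, there is a bounded isomorphism from $\mathcal K$ onto $\mathrm{Rng}(T+iI)^\perp$, and for every self-adjoint extension $T'$ of $T$ in $\mathcal H$ and every bounded isomorphism $j$ from $\mathcal K$ onto $\mathrm{Rng}(T+iI)^\perp$, the formula $$\Gamma(\lambda)=(T'-iI)(T'-\overline\lambda I)^{-1}j,\qquad \lambda\in\mathbb C\setminus\mathbb R,$$ defines a function $\mathbb C\setminus\mathbb R\to\mathcal B(\mathcal K,\mathcal H)$ that is a model for $T$. -/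

import Mathlib

open scoped ComplexConjugate

noncomputable section

namespace SymmetricOperator

section Dimension

variable (E : Type*) [NormedAddCommGroup E] [InnerProductSpace ℂ E]

/-- The Hilbert-space dimension of `E` is `n`: some orthonormal basis of `E`
(complete orthonormal set) has exactly `n` elements, where `n = ⊤` means infinitely many
(so countably many when `E` is separable). -/
def HasHilbertDim (n : ℕ∞) : Prop :=
  ∃ (s : Set E) (b : HilbertBasis s ℂ E), ⇑b = ((↑) : s → E) ∧ s.encard = n

end Dimension

variable {H : Type*} [NormedAddCommGroup H] [InnerProductSpace ℂ H]

/-- `Rng (T - w I)` for a partially defined operator `T`. -/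
def rng (T : H →ₗ.[ℂ] H) (w : ℂ) : Submodule ℂ H :=
  LinearMap.range (T.toFun - w • T.domain.subtype)

theorem mem_rng_iff (T : H →ₗ.[ℂ] H) (w : ℂ) (y : H) :
    y ∈ rng T w ↔ ∃ x : T.domain, T x - w • (x : H) = y :=
  Iff.rfl

/-- The class `𝒮ₙ(H)`: densely defined, closed, symmetric, simple operators with deficiency
indices `(n, n)`. -/
structure IsSimpleSymmetric (n : ℕ∞) (T : H →ₗ.[ℂ] H) : Prop where
  dense : Dense (T.domain : Set H)
  symmetric : ∀ x y : T.domain, inner ℂ (T x) (y : H) = inner ℂ (x : H) (T y)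
  closed : IsClosed (T.graph : Set (H × H))
  simple : ⨅ w : {w : ℂ // w.im ≠ 0}, rng T w = ⊥
  deficiency_minus : HasHilbertDim (rng T Complex.I)ᗮ n
  deficiency_plus : HasHilbertDim (rng T (-Complex.I))ᗮ n

variable {K : Type*} [NormedAddCommGroup K] [InnerProductSpace ℂ K]

/-- `Γ : ℂ \ ℝ → B(K, H)` is a model for `T`. Only the values of `Γ` off the real axis matter. -/
structure IsModel [CompleteSpace H] [CompleteSpace K]
    (T : H →ₗ.[ℂ] H) (Γ : ℂ → K →L[ℂ] H) : Prop where
  /-- `Γ` is co-analytic on `ℂ \ ℝ`, i.e. `z ↦ Γ (conj z)` is analytic there, in operator norm. -/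
  coanalytic : AnalyticOnNhd ℂ (fun z => Γ (conj z)) {z : ℂ | z.im ≠ 0}
  /-- `Γ w` is a bounded invertible operator from `K` onto the Hilbert space `Rng (T - w I)ᗮ`. -/
  invertible : ∀ w : ℂ, w.im ≠ 0 → ∃ e : K ≃L[ℂ] (rng T w)ᗮ, ∀ k : K, Γ w k = (e k : H)
  kernel_invertible : ∀ z w : ℂ, (0 < z.im ∧ 0 < w.im) ∨ (z.im < 0 ∧ w.im < 0) →
    IsUnit ((ContinuousLinearMap.adjoint (Γ z)) ∘L (Γ w))
  /-- The closed linear span of all the ranges is `H`. -/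
  span_eq_top : (⨆ w : {w : ℂ // w.im ≠ 0},
    LinearMap.range (Γ w : K →ₗ[ℂ] H)).topologicalClosure = ⊤

/-- `T'` is a self-adjoint extension of `T` (in the same Hilbert space). -/
def IsSelfAdjointExtension [CompleteSpace H] (T T' : H →ₗ.[ℂ] H) : Prop :=
  T ≤ T' ∧ T'.adjoint = T'

/-- `Γ w = (T' - i I) (T' - conj w I)⁻¹ j` for all non-real `w`: for each `k`, the vector `x` is
`(T' - conj w I)⁻¹ (j k)`. -/
def IsKreinMap {T : H →ₗ.[ℂ] H} (T' : H →ₗ.[ℂ] H)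
    (j : K ≃L[ℂ] (rng T (-Complex.I))ᗮ) (Γ : ℂ → K →L[ℂ] H) : Prop :=
  ∀ w : ℂ, w.im ≠ 0 → ∀ k : K, ∃ x : T'.domain,
    T' x - conj w • (x : H) = (j k : H) ∧ Γ w k = T' x - Complex.I • (x : H)

end SymmetricOperator

end

/-! Everything rests on the reality of `⟨x, Tx⟩`, which gives `|Im w| ‖x‖ ≤ ‖(T - w)x‖`. Hence the
ranges are closed, and a self-adjoint `S` has a bounded resolvent at every non-real point. Equal
deficiency indices give a unitary between the defect spaces at `±i`, hence von Neumann's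
self-adjoint extension (`exists_isSelfAdjointExtension`).

For such an extension `S`, the operator `(S - b)(S - a)⁻¹` has inverse `(S - a)(S - b)⁻¹` and
carries defect space to defect space (`transfer_mem`). This gives invertibility of `Γ`;
co-analyticity follows because one of the two is affine in `a` and the other is its inverse. By a
quantitative separation of defect spaces from ranges in one half-plane (`exists_le_norm_add`),
`Γ(z)* Γ(w)` and its adjoint are bounded below, so it is invertible. Simplicity is dual to density
of the span. -/

namespace SymmetricOperator

/-! ### Hilbert dimension and isometric isomorphism. -/

section Dimension

variable {E : Type*} [NormedAddCommGroup E] [InnerProductSpace ℂ E]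

/-- Two members of an orthonormal set are at distance `√2`, so a separable space has only
countable ones. -/
theorem _root_.Orthonormal.countable_of_separable [TopologicalSpace.SeparableSpace E]
    {ι : Type*} {v : ι → E} (hv : Orthonormal ℂ v) : Countable ι := by
  have hdist : ∀ i j, i ≠ j → 1 < dist (v i) (v j) := by
    intro i j hij
    have h := norm_sub_sq (𝕜 := ℂ) (v i) (v j)
    rw [hv.2 hij, hv.1 i, hv.1 j] at h
    rw [dist_eq_norm]
    norm_num at h
    nlinarith [norm_nonneg (v i - v j)]
  refine Pairwise.countable_of_isOpen_disjoint (s := fun i => Metric.ball (v i) (1 / 2))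
    (fun i j hij => ?_) (fun _ => Metric.isOpen_ball)
    (fun i => ⟨v i, Metric.mem_ball_self (by norm_num)⟩)
  refine Metric.ball_disjoint_ball ?_
  linarith [hdist i j hij]

/-- Separable Hilbert spaces of the same dimension are isometrically isomorphic. -/
theorem HasHilbertDim.nonempty_linearIsometryEquiv [TopologicalSpace.SeparableSpace E]
    {F : Type*} [NormedAddCommGroup F] [InnerProductSpace ℂ F]
    [TopologicalSpace.SeparableSpace F] {n : ℕ∞}
    (hE : HasHilbertDim E n) (hF : HasHilbertDim F n) : Nonempty (E ≃ₗᵢ[ℂ] F) := by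
  obtain ⟨s, b, -, hs⟩ := hE
  obtain ⟨t, c, -, ht⟩ := hF
  have : Countable s := b.orthonormal.countable_of_separable
  have : Countable t := c.orthonormal.countable_of_separable
  have hst : Nonempty (s ≃ t) := by
    rcases s.finite_or_infinite with hfin | hinf
    · have hfin' : t.Finite := by
        rw [← Set.encard_ne_top_iff, ht, ← hs]
        exact hfin.encard_lt_top.ne
      have := hfin.to_subtype
      have := hfin'.to_subtype
      refine Finite.card_eq.mp ?_
      simp only [Nat.card_coe_set_eq, Set.ncard, hs, ht]
    · have hinf' : t.Infinite := by
        rw [← Set.encard_eq_top_iff, ht, ← hs]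
        exact hinf.encard_eq
      have := hinf.to_subtype
      have := hinf'.to_subtype
      exact nonempty_equiv_of_countable
  obtain ⟨e⟩ := hst
  have hcomplete : CompleteSpace F :=
    (completeSpace_congr (e := c.repr.toEquiv) c.repr.isometry.isUniformEmbedding).mpr inferInstance
  -- The basis `c` reindexed by `s`, so that both coordinate maps land in the same `ℓ²` space.
  let c' : HilbertBasis s ℂ F := HilbertBasis.mk (c.orthonormal.comp e e.injective) (by
    rw [e.surjective.range_comp]
    exact c.dense_span.ge)
  exact ⟨b.repr.trans c'.repr.symm⟩

end Dimension

variable {H : Type*} [NormedAddCommGroup H] [InnerProductSpace ℂ H]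

/-! ### Estimates for symmetric operators. -/

section Symmetric

variable {T : H →ₗ.[ℂ] H}

/-- Weak form of `T* f = conj w • f`, which needs neither the adjoint nor a dense domain. -/
theorem mem_rng_orthogonal_iff {w : ℂ} {f : H} :
    f ∈ (rng T w)ᗮ ↔ ∀ x : T.domain, inner ℂ (T x) f = conj w * inner ℂ (x : H) f := by
  rw [Submodule.mem_orthogonal]
  constructor
  · intro h x
    have := h _ ((mem_rng_iff T w _).mpr ⟨x, rfl⟩)
    rwa [inner_sub_left, inner_smul_left, sub_eq_zero] at this
  · rintro h _ ⟨x, rfl⟩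
    change inner ℂ (T x - w • (x : H)) f = 0
    rw [inner_sub_left, inner_smul_left, h x, sub_self]

/-- The quadratic form of a symmetric operator is real. -/
theorem inner_self_apply_im (hsym : T.IsFormalAdjoint T) (x : T.domain) :
    (inner ℂ (x : H) (T x)).im = 0 := by
  have h := hsym x x
  rw [← inner_conj_symm] at h
  exact Complex.conj_eq_iff_im.mp h

/-- Since `⟨x, Tx⟩` is real, `Im ⟨x, (T - w)x⟩ = -Im w ‖x‖²`; Cauchy–Schwarz finishes. -/
theorem abs_im_mul_norm_le (hsym : T.IsFormalAdjoint T) (w : ℂ) (x : T.domain) :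
    |w.im| * ‖(x : H)‖ ≤ ‖T x - w • (x : H)‖ := by
  have him : (inner ℂ (x : H) (T x - w • (x : H))).im = -w.im * ‖(x : H)‖ ^ 2 := by
    rw [inner_sub_right, inner_smul_right, Complex.sub_im, inner_self_apply_im hsym,
      inner_self_eq_norm_sq_to_K]
    simp [← Complex.ofReal_pow]
  have hle : |w.im| * ‖(x : H)‖ ^ 2 ≤ ‖(x : H)‖ * ‖T x - w • (x : H)‖ := by
    refine le_trans (le_of_eq ?_) ((Complex.abs_im_le_norm _).trans (norm_inner_le_norm _ _))
    rw [him, abs_mul, abs_neg, abs_of_nonneg (sq_nonneg ‖(x : H)‖)]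
  rcases (norm_nonneg (x : H)).eq_or_lt with h0 | hpos
  · rw [← h0, mul_zero]
    exact norm_nonneg _
  · refine le_of_mul_le_mul_left ?_ hpos
    linarith

theorem eq_of_sub_smul_eq (hsym : T.IsFormalAdjoint T) {w : ℂ} (hw : w.im ≠ 0) {x y : T.domain}
    (h : T x - w • (x : H) = T y - w • (y : H)) : x = y := by
  have hle := abs_im_mul_norm_le hsym w (x - y)
  have hzero : T (x - y) - w • ((x - y : T.domain) : H) = 0 := by
    rw [T.map_sub, Submodule.coe_sub, smul_sub, ← sub_eq_zero.mpr h]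
    abel
  rw [hzero, norm_zero] at hle
  have : ‖((x - y : T.domain) : H)‖ = 0 :=
    le_antisymm (nonpos_of_mul_nonpos_right hle (abs_pos.mpr hw)) (norm_nonneg _)
  rw [norm_eq_zero, Submodule.coe_sub, sub_eq_zero] at this
  exact Subtype.ext this

theorem isClosed_rng [CompleteSpace H] (hsym : T.IsFormalAdjoint T)
    (hcl : IsClosed (T.graph : Set (H × H))) {w : ℂ} (hw : w.im ≠ 0) :
    IsClosed (rng T w : Set H) := by
  -- On the complete space `T.graph`, the map `(x, Tx) ↦ Tx - w x` is bounded below, so its range is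
  -- closed.
  let φ : T.graph →L[ℂ] H :=
    (ContinuousLinearMap.snd ℂ H H - w • ContinuousLinearMap.fst ℂ H H).comp T.graph.subtypeL
  have hφ : ∀ p : T.graph, φ p = p.1.2 - w • p.1.1 := fun _ => rfl
  have hpos : 0 < |w.im| := abs_pos.mpr hw
  have hanti : AntilipschitzWith (Real.toNNReal (1 + (1 + ‖w‖) / |w.im|)) φ := by
    refine φ.antilipschitz_of_bound fun p => ?_
    obtain ⟨⟨a, b⟩, hp⟩ := p
    obtain ⟨x, rfl, rfl⟩ := (LinearPMap.mem_graph_iff T).mp hp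
    have h1 := abs_im_mul_norm_le hsym w x
    have h2 : ‖T x‖ ≤ ‖T x - w • (x : H)‖ + ‖w‖ * ‖(x : H)‖ := by
      rw [← norm_smul]
      exact norm_le_norm_sub_add _ _
    rw [hφ, Real.coe_toNNReal _ (by positivity)]
    change max ‖(x : H)‖ ‖T x‖ ≤ _ * ‖T x - w • (x : H)‖
    set q := ‖T x - w • (x : H)‖
    have h3 : ‖(x : H)‖ ≤ q / |w.im| := by rwa [le_div_iff₀' hpos]
    have h4 : ‖w‖ * ‖(x : H)‖ ≤ ‖w‖ * (q / |w.im|) := by gcongr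
    have h5 : 0 ≤ q := norm_nonneg _
    have h6 : (1 + (1 + ‖w‖) / |w.im|) * q = q + q / |w.im| + ‖w‖ * (q / |w.im|) := by ring
    have h7 : 0 ≤ ‖w‖ * (q / |w.im|) := by positivity
    have h8 : 0 ≤ q / |w.im| := by positivity
    rw [h6]
    exact max_le (by linarith) (by linarith)
  have : CompleteSpace T.graph := hcl.completeSpace_coe
  convert hanti.isClosed_range φ.uniformContinuous
  ext y
  constructor
  · rintro ⟨x, rfl⟩
    exact ⟨⟨_, T.mem_graph x⟩, rfl⟩
  · rintro ⟨⟨⟨a, b⟩, hp⟩, rfl⟩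
    obtain ⟨x, rfl, rfl⟩ := (LinearPMap.mem_graph_iff T).mp hp
    exact ⟨x, rfl⟩

/-- For `w` and `z` in the same open half-plane, a vector of the defect space of `w` keeps a
fixed distance from `Rng (T - z I)`. -/
theorem exists_le_norm_add (hsym : T.IsFormalAdjoint T) {z w : ℂ} (hzw : 0 < z.im * w.im) :
    ∃ c : ℝ, 0 < c ∧ ∀ f ∈ (rng T w)ᗮ, ∀ q ∈ rng T z, c * ‖f‖ ≤ ‖f + q‖ := by
  -- Formally `T* g = conj w • g`, so `(T* - z)g = d • g`. With `f = d • g` and `u = y + g`, the sum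
  -- `f + (T - z)y` becomes `(T* - z)u`, whose pairing with `u` has a computable imaginary part.
  set d : ℂ := conj w - z with hd_def
  have hd : d ≠ 0 := by
    intro h
    have : d.im = -w.im - z.im := by simp [hd_def]
    rw [h, Complex.zero_im] at this
    have hw : w.im = -z.im := by linarith
    rw [hw] at hzw
    nlinarith [sq_nonneg z.im]
  have hdn : 0 < ‖d‖ := norm_pos_iff.mpr hd
  refine ⟨Real.sqrt (z.im * w.im) / ‖d‖, by positivity, ?_⟩
  rintro f hf _ ⟨y, rfl⟩
  change _ ≤ ‖f + (T y - z • (y : H))‖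
  set g : H := d⁻¹ • f with hg_def
  have hfg : f = d • g := by rw [hg_def, smul_inv_smul₀ hd]
  have hg : inner ℂ (T y) g = conj w * inner ℂ (y : H) g :=
    mem_rng_orthogonal_iff.mp (Submodule.smul_mem _ _ hf) y
  set u : H := y + g with hu_def
  have hq : f + (T y - z • (y : H)) = (T y + conj w • g) - z • u := by
    rw [hfg, hu_def, hd_def]
    module
  have him : (inner ℂ u ((T y + conj w • g) - z • u)).im
      = -(w.im * ‖g‖ ^ 2 + z.im * ‖u‖ ^ 2) := by
    have h1 : (inner ℂ u (T y + conj w • g)).im = -(w.im * ‖g‖ ^ 2) := by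
      have hg' : inner ℂ g (T y) = w * inner ℂ g (y : H) := by
        rw [← inner_conj_symm, hg, map_mul, inner_conj_symm, Complex.conj_conj]
      rw [hu_def, inner_add_left, inner_add_right, inner_add_right, inner_smul_right _ g,
        inner_smul_right g g, hg', inner_self_eq_norm_sq_to_K]
      have h2 : (w * inner ℂ g (y : H) + conj w * inner ℂ (y : H) g).im = 0 := by
        rw [← inner_conj_symm g (y : H), ← Complex.conj_eq_iff_im]
        simp [add_comm]
      have h3 := inner_self_apply_im hsym y
      simp only [Complex.add_im] at h2 ⊢
      rw [h3]
      have h4 : (conj w * ((‖g‖ : ℂ)) ^ 2).im = -(w.im * ‖g‖ ^ 2) := by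
        simp [← Complex.ofReal_pow]
      have h5 : ((RCLike.ofReal ‖g‖ : ℂ)) = (‖g‖ : ℂ) := rfl
      rw [h5]
      linarith
    rw [inner_sub_right, inner_smul_right, Complex.sub_im, h1, inner_self_eq_norm_sq_to_K]
    simp [← Complex.ofReal_pow]
    ring
  rw [hq]
  set Q : ℝ := ‖(T y + conj w • g) - z • u‖
  have hle : |w.im * ‖g‖ ^ 2 + z.im * ‖u‖ ^ 2| ≤ ‖u‖ * Q := by
    rw [← abs_neg, ← him]
    exact (Complex.abs_im_le_norm _).trans (norm_inner_le_norm _ _)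
  -- With `a = Im w ‖g‖²` and `b = Im z ‖u‖²`, the half-plane condition gives `ab ≥ 0`, so `ab ≤ (a
  -- + b)² ≤ ‖u‖² Q²`; then `‖u‖²` is cancelled.
  have hsq : z.im * w.im * ‖g‖ ^ 2 ≤ Q ^ 2 := by
    have hsq' := mul_self_le_mul_self (abs_nonneg _) hle
    rw [abs_mul_abs_self] at hsq'
    have hu0 : 0 ≤ ‖u‖ ^ 2 := sq_nonneg _
    rcases hu0.eq_or_lt with h0 | hpos
    · have hu : ‖u‖ = 0 := by simpa using h0.symm
      rw [hu] at hsq'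
      have : w.im * ‖g‖ ^ 2 = 0 := by nlinarith
      rw [mul_assoc, this, mul_zero]
      exact sq_nonneg Q
    · refine le_of_mul_le_mul_left ?_ hpos
      have h1 : 0 ≤ z.im * w.im * ‖g‖ ^ 2 * ‖u‖ ^ 2 := by positivity
      nlinarith [sq_nonneg (w.im * ‖g‖ ^ 2), sq_nonneg (z.im * ‖u‖ ^ 2)]
  have hng : ‖f‖ = ‖d‖ * ‖g‖ := by rw [hfg, norm_smul]
  rw [hng, div_mul_eq_mul_div, mul_left_comm, mul_div_cancel_left₀ _ hdn.ne']
  refine (sq_le_sq₀ (by positivity) (norm_nonneg _)).mp ?_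
  rwa [mul_pow, Real.sq_sqrt hzw.le]

end Symmetric

/-! ### Resolvents and transfer operators of self-adjoint operators. -/

section SelfAdjoint

variable [CompleteSpace H] {S : H →ₗ.[ℂ] H}

theorem isFormalAdjoint_self_of_adjoint_eq (hS : S.adjoint = S) : S.IsFormalAdjoint S := by
  have hdense : Dense (S.domain : Set H) :=
    IsSelfAdjoint.dense_domain (LinearPMap.isSelfAdjoint_def.mpr hS)
  have h := S.adjoint_isFormalAdjoint hdense
  rwa [hS] at h

theorem rng_eq_top_of_adjoint_eq (hS : S.adjoint = S) {w : ℂ} (hw : w.im ≠ 0) :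
    rng S w = ⊤ := by
  have hsa : IsSelfAdjoint S := LinearPMap.isSelfAdjoint_def.mpr hS
  have hsym := isFormalAdjoint_self_of_adjoint_eq hS
  have hcl : IsClosed (rng S w : Set H) := isClosed_rng hsym hsa.isClosed hw
  have : CompleteSpace (rng S w) := hcl.completeSpace_coe
  rw [← Submodule.orthogonal_eq_bot_iff, Submodule.eq_bot_iff]
  intro f hf
  rw [mem_rng_orthogonal_iff] at hf
  -- A vector orthogonal to the closed range is an eigenvector of `S* = S` at the non-real point
  -- `conj w`, hence zero.
  have hf' : ∀ x : S.domain, inner ℂ (conj w • f) (x : H) = inner ℂ f (S x) := by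
    intro x
    rw [← inner_conj_symm f, hf x, inner_smul_left, map_mul, inner_conj_symm]
  have hmem : f ∈ S.adjoint.domain := S.mem_adjoint_domain_of_exists f ⟨_, hf'⟩
  have happ : S.adjoint ⟨f, hmem⟩ = conj w • f :=
    LinearPMap.adjoint_apply_eq hsa.dense_domain _ hf'
  obtain ⟨x, hxf, hx⟩ : ∃ x : S.domain, (x : H) = f ∧ S x = conj w • f := by
    have hg : (f, conj w • f) ∈ S.adjoint.graph :=
      (LinearPMap.mem_graph_iff _).mpr ⟨⟨f, hmem⟩, rfl, happ⟩
    rw [hS] at hg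
    exact (LinearPMap.mem_graph_iff _).mp hg
  have hx0 : x = 0 := by
    refine eq_of_sub_smul_eq hsym (w := conj w) (by simpa using hw) ?_
    simp [hx, hxf]
  rw [← hxf, hx0, Submodule.coe_zero]

/-- `(S - a I)⁻¹` is a bounded operator, for self-adjoint `S` and non-real `a`. -/
theorem exists_resolvent (hS : S.adjoint = S) {a : ℂ} (ha : a.im ≠ 0) :
    ∃ R : H →L[ℂ] H, ∀ h : H, ∃ x : S.domain, S x - a • (x : H) = h ∧ R h = x := by
  have hsym := isFormalAdjoint_self_of_adjoint_eq hS
  have hsurj : ∀ h : H, ∃ x : S.domain, S x - a • (x : H) = h := by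
    intro h
    rw [← mem_rng_iff, rng_eq_top_of_adjoint_eq hS ha]
    trivial
  choose r hr using hsurj
  let R : H →ₗ[ℂ] H :=
    { toFun := fun h => r h
      map_add' := fun h k => by
        rw [← Submodule.coe_add]
        congr 1
        refine eq_of_sub_smul_eq hsym ha ?_
        rw [hr, S.map_add, Submodule.coe_add, smul_add, add_sub_add_comm, hr, hr]
      map_smul' := fun c h => by
        rw [RingHom.id_apply, ← Submodule.coe_smul]
        congr 1
        refine eq_of_sub_smul_eq hsym ha ?_
        rw [hr, S.map_smul, Submodule.coe_smul, smul_comm a c, ← smul_sub, hr] }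
  refine ⟨R.mkContinuous |a.im|⁻¹ fun h => ?_, fun h => ⟨r h, hr h, rfl⟩⟩
  change ‖(r h : H)‖ ≤ _
  rw [inv_mul_eq_div, le_div_iff₀' (abs_pos.mpr ha)]
  simpa only [hr] using abs_im_mul_norm_le hsym a (r h)

open scoped Classical in
/-- The resolvent `(S - a I)⁻¹`, or `0` if it does not exist as a bounded operator. -/
noncomputable def resolvent (S : H →ₗ.[ℂ] H) (a : ℂ) : H →L[ℂ] H :=
  if h : ∃ R : H →L[ℂ] H, ∀ h : H, ∃ x : S.domain, S x - a • (x : H) = h ∧ R h = x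
  then h.choose else 0

theorem resolvent_spec (hS : S.adjoint = S) {a : ℂ} (ha : a.im ≠ 0) (h : H) :
    ∃ x : S.domain, S x - a • (x : H) = h ∧ resolvent S a h = x := by
  rw [resolvent, dif_pos (exists_resolvent hS ha)]
  exact (exists_resolvent hS ha).choose_spec h

/-- The bounded operator `(S - b I) (S - a I)⁻¹`. -/
noncomputable def transfer (S : H →ₗ.[ℂ] H) (a b : ℂ) : H →L[ℂ] H :=
  1 + (a - b) • resolvent S a

theorem transfer_apply_eq (hS : S.adjoint = S) {a : ℂ} (ha : a.im ≠ 0) (b : ℂ) (x : S.domain) :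
    transfer S a b (S x - a • (x : H)) = S x - b • (x : H) := by
  obtain ⟨y, hy, hRy⟩ := resolvent_spec hS ha (S x - a • (x : H))
  obtain rfl := eq_of_sub_smul_eq (isFormalAdjoint_self_of_adjoint_eq hS) ha hy
  change (S y - a • (y : H)) + (a - b) • resolvent S a (S y - a • (y : H)) = _
  rw [hRy]
  module

theorem transfer_transfer (hS : S.adjoint = S) {a b : ℂ} (ha : a.im ≠ 0) (hb : b.im ≠ 0) (h : H) :
    transfer S b a (transfer S a b h) = h := by
  obtain ⟨x, rfl, -⟩ := resolvent_spec hS ha h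
  rw [transfer_apply_eq hS ha, transfer_apply_eq hS hb]

theorem transfer_eq_inverse (hS : S.adjoint = S) {a b : ℂ} (ha : a.im ≠ 0) (hb : b.im ≠ 0) :
    transfer S a b = Ring.inverse (transfer S b a) := by
  let u : (H →L[ℂ] H)ˣ :=
    { val := transfer S b a
      inv := transfer S a b
      val_inv := ContinuousLinearMap.ext fun h => transfer_transfer hS ha hb h
      inv_val := ContinuousLinearMap.ext fun h => transfer_transfer hS hb ha h }
  exact (Ring.inverse_unit u).symm

theorem analyticOnNhd_transfer (hS : S.adjoint = S) {b : ℂ} (hb : b.im ≠ 0) :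
    AnalyticOnNhd ℂ (fun a => transfer S a b) {a : ℂ | a.im ≠ 0} := by
  have hopen : IsOpen {a : ℂ | a.im ≠ 0} := isOpen_ne_fun Complex.continuous_im continuous_const
  refine DifferentiableOn.analyticOnNhd ?_ hopen
  -- `transfer S b a` is affine in `a`, and inversion is differentiable at units, so no resolvent
  -- expansion is needed.
  have hinv : DifferentiableOn ℂ (fun a => Ring.inverse (transfer S b a)) {a : ℂ | a.im ≠ 0} := by
    intro a ha
    let u : (H →L[ℂ] H)ˣ :=
      { val := transfer S b a
        inv := transfer S a b
        val_inv := ContinuousLinearMap.ext fun h => transfer_transfer hS ha hb h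
        inv_val := ContinuousLinearMap.ext fun h => transfer_transfer hS hb ha h }
    have haff : DifferentiableAt ℂ (fun a => transfer S b a) a := by
      unfold transfer
      fun_prop
    exact ((differentiableAt_inverse (𝕜 := ℂ) u.isUnit).comp a haff).differentiableWithinAt
  exact hinv.congr fun a ha => transfer_eq_inverse hS ha hb

/-- Writing `f = (S - a)x`, orthogonality to `(T - conj b)y` expands to `⟨Ty, Sx⟩ - (a + b)⟨y, Sx⟩ +
ab⟨y, x⟩ = 0`. This is symmetric in `a` and `b`, so `(S - b)x` is orthogonal to `(T - conj a)y`. -/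
theorem transfer_mem {T : H →ₗ.[ℂ] H} (hTS : T ≤ S) (hS : S.adjoint = S) {a b : ℂ}
    (ha : a.im ≠ 0) {f : H} (hf : f ∈ (rng T (conj b))ᗮ) :
    transfer S a b f ∈ (rng T (conj a))ᗮ := by
  obtain ⟨x, rfl, -⟩ := resolvent_spec hS ha f
  rw [mem_rng_orthogonal_iff] at hf
  rw [transfer_apply_eq hS ha, mem_rng_orthogonal_iff]
  intro y
  obtain ⟨y', hy'⟩ : ∃ y' : S.domain, (y' : H) = y ∧ T y = S y' :=
    ⟨⟨y, hTS.1 y.2⟩, rfl, hTS.2 rfl⟩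
  have hsym : inner ℂ (T y) (x : H) = inner ℂ (y : H) (S x) := by
    rw [hy'.2, ← hy'.1]
    exact isFormalAdjoint_self_of_adjoint_eq hS y' x
  have h := hf y
  simp only [inner_sub_right, inner_smul_right, Complex.conj_conj, hsym] at h ⊢
  linear_combination h

end SelfAdjoint

/-! ### Von Neumann's self-adjoint extension. -/

section Extension

variable [CompleteSpace H] {T : H →ₗ.[ℂ] H}

/-- A densely defined symmetric operator with `Rng (S + i I) = Rng (S - i I) = H` is
self-adjoint. -/
theorem adjoint_eq_self_of_rng_eq_top {S : H →ₗ.[ℂ] H} (hd : Dense (S.domain : Set H))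
    (hsym : S.IsFormalAdjoint S) (hp : rng S (-Complex.I) = ⊤) (hm : rng S Complex.I = ⊤) :
    S.adjoint = S := by
  have hle : S ≤ S.adjoint := hsym.le_adjoint hd
  refine (LinearPMap.eq_of_le_of_domain_eq hle (le_antisymm hle.1 fun y hy => ?_)).symm
  -- Solving `(S + i)x = (S* + i)y` puts `y - x` in `ker (S* + i) = Rng (S - i)ᗮ`, which is zero.
  obtain ⟨x, hx⟩ : ∃ x : S.domain,
      S x - (-Complex.I) • (x : H) = S.adjoint ⟨y, hy⟩ - (-Complex.I) • y := by
    rw [← mem_rng_iff, hp]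
    trivial
  have hv : y - x ∈ (rng S Complex.I)ᗮ := by
    rw [mem_rng_orthogonal_iff]
    intro u
    have h1 : inner ℂ (S u) y = inner ℂ (u : H) (S.adjoint ⟨y, hy⟩) :=
      (S.adjoint_isFormalAdjoint hd).symm u ⟨y, hy⟩
    have h2 : S.adjoint ⟨y, hy⟩ = S x - (-Complex.I) • (x : H) + (-Complex.I) • y :=
      (sub_eq_iff_eq_add.mp hx.symm)
    rw [inner_sub_right, h1, hsym u x, h2]
    simp only [inner_add_right, inner_sub_right, inner_smul_right, Complex.conj_I]
    ring
  rw [hm, Submodule.top_orthogonal_eq_bot, Submodule.mem_bot, sub_eq_zero] at hv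
  rw [hv]
  exact x.2

/-- Von Neumann's extension: a unitary between the defect spaces of a closed symmetric operator
gives a self-adjoint extension. -/
theorem exists_isSelfAdjointExtension (hd : Dense (T.domain : Set H))
    (hsym : T.IsFormalAdjoint T) (hcl : IsClosed (T.graph : Set (H × H)))
    (W : (rng T (-Complex.I))ᗮ ≃ₗᵢ[ℂ] (rng T Complex.I)ᗮ) :
    ∃ S : H →ₗ.[ℂ] H, IsSelfAdjointExtension T S := by
  let N := (rng T (-Complex.I))ᗮ
  let ι : N →ₗ[ℂ] H := N.subtype
  let ω : N →ₗ[ℂ] H := (rng T Complex.I)ᗮ.subtype ∘ₗ W.toLinearEquiv.toLinearMap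
  -- Here `T* f = i f` and `T* (W f) = -i W f`, so the range of `Φ` is the graph of `T*` restricted
  -- to the vectors `x + f - W f`.
  let Φ : T.domain × N →ₗ[ℂ] H × H :=
    (T.domain.subtype.coprod (ι - ω)).prod (T.toFun.coprod (Complex.I • (ι + ω)))
  have hΦ : ∀ x f, Φ (x, f) =
      ((x : H) + ((f : H) - (W f : H)), T x + Complex.I • ((f : H) + (W f : H))) :=
    fun _ _ => rfl
  have hι : ∀ (x : T.domain) (f : N),
      inner ℂ (T x) (f : H) = Complex.I * inner ℂ (x : H) (f : H) := by
    intro x f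
    simpa using mem_rng_orthogonal_iff.mp f.2 x
  have hω : ∀ (x : T.domain) (f : N),
      inner ℂ (T x) (W f : H) = -Complex.I * inner ℂ (x : H) (W f : H) := by
    intro x f
    simpa using mem_rng_orthogonal_iff.mp (W f).2 x
  have hι' : ∀ (x : T.domain) (f : N),
      inner ℂ (f : H) (T x) = -Complex.I * inner ℂ (f : H) (x : H) := by
    intro x f
    rw [← inner_conj_symm, hι, map_mul, inner_conj_symm, Complex.conj_I]
  have hω' : ∀ (x : T.domain) (f : N),
      inner ℂ (W f : H) (T x) = Complex.I * inner ℂ (W f : H) (x : H) := by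
    intro x f
    rw [← inner_conj_symm, hω, map_mul, inner_conj_symm, map_neg, Complex.conj_I, neg_neg]
  have hW : ∀ f g : N, inner ℂ (W f : H) (W g : H) = inner ℂ (f : H) (g : H) :=
    fun f g => W.inner_map_map f g
  -- Symmetry: the terms in `f` and in `W f` cancel because `W` is isometric.
  have hG : ∀ p ∈ LinearMap.range Φ, ∀ q ∈ LinearMap.range Φ,
      inner ℂ p.2 q.1 = inner ℂ p.1 q.2 := by
    rintro _ ⟨⟨x, f⟩, rfl⟩ _ ⟨⟨y, g⟩, rfl⟩
    have hxy := hsym x y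
    rw [hΦ, hΦ]
    simp only [inner_add_left, inner_add_right, inner_sub_left, inner_sub_right, inner_smul_left,
      inner_smul_right, hι, hω, hι', hω', hW, hxy, Complex.conj_I]
    ring
  have hfun : ∀ p ∈ LinearMap.range Φ, p.1 = 0 → p.2 = 0 := by
    intro p hp hp0
    refine hd.eq_zero_of_inner_left ℂ fun x hx => ?_
    have h := hG p hp _ ⟨(⟨x, hx⟩, 0), rfl⟩
    rw [hΦ, hp0] at h
    simpa using h
  let S := (LinearMap.range Φ).toLinearPMap
  have hSG : S.graph = LinearMap.range Φ := Submodule.toLinearPMap_graph_eq _ hfun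
  have hval : ∀ (x : T.domain) (f : N), ∃ u : S.domain, (u : H) = (x : H) + ((f : H) - (W f : H)) ∧
      S u = T x + Complex.I • ((f : H) + (W f : H)) := by
    intro x f
    have : Φ (x, f) ∈ S.graph := hSG ▸ ⟨(x, f), rfl⟩
    rw [hΦ] at this
    exact (LinearPMap.mem_graph_iff _).mp this
  have hTS : T ≤ S := by
    refine LinearPMap.le_of_le_graph fun p hp => ?_
    obtain ⟨x, hx1, hx2⟩ := (LinearPMap.mem_graph_iff _).mp hp
    rw [hSG]
    refine ⟨(x, 0), ?_⟩
    rw [hΦ]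
    exact Prod.ext (by simp [hx1]) (by simp [hx2])
  have hSd : Dense (S.domain : Set H) := hd.mono hTS.1
  have hSsym : S.IsFormalAdjoint S := fun x y =>
    hG _ (hSG ▸ S.mem_graph x) _ (hSG ▸ S.mem_graph y)
  have htop : ∀ w : ℂ, w.im ≠ 0 → (rng T w)ᗮ ≤ rng S w → rng S w = ⊤ := by
    intro w hw hle
    have : CompleteSpace (rng T w) := (isClosed_rng hsym hcl hw).completeSpace_coe
    rw [eq_top_iff, ← Submodule.sup_orthogonal_of_hasOrthogonalProjection (K := rng T w)]
    refine sup_le ?_ hle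
    rintro _ ⟨x, rfl⟩
    obtain ⟨u, hu1, hu2⟩ := hval x 0
    refine (mem_rng_iff S w _).mpr ⟨u, ?_⟩
    rw [hu1, hu2]
    simp
  -- For `u = f - W f` one has `(S + i)u = 2i f` and `(S - i)u = 2i W f`, so each range contains the
  -- missing defect space.
  have h2I : (2 * Complex.I) ≠ 0 := by simp
  refine ⟨S, hTS, adjoint_eq_self_of_rng_eq_top hSd hSsym ?_ ?_⟩
  · refine htop _ (by simp) fun f hf => ?_
    rw [← inv_smul_smul₀ h2I f]
    refine Submodule.smul_mem _ _ ?_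
    obtain ⟨u, hu1, hu2⟩ := hval 0 ⟨f, hf⟩
    refine (mem_rng_iff S _ _).mpr ⟨u, ?_⟩
    rw [hu1, hu2, T.map_zero, Submodule.coe_zero]
    module
  · refine htop _ (by simp) fun f hf => ?_
    rw [← inv_smul_smul₀ h2I f]
    refine Submodule.smul_mem _ _ ?_
    obtain ⟨u, hu1, hu2⟩ := hval 0 (W.symm ⟨f, hf⟩)
    refine (mem_rng_iff S _ _).mpr ⟨u, ?_⟩
    rw [hu1, hu2, T.map_zero, Submodule.coe_zero, W.apply_symm_apply]
    module

end Extension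

/-! ### The Krein map and the model axioms. -/

section Model

variable [CompleteSpace H] {K : Type*} [NormedAddCommGroup K] [InnerProductSpace ℂ K]

/-- An operator between Hilbert spaces is invertible once it and its adjoint are bounded below. -/
theorem isUnit_of_bounded_below [CompleteSpace K] {A : K →L[ℂ] K} {c d : ℝ} (hc : 0 < c) (hd : 0 < d)
    (hA : ∀ k, c * ‖k‖ ≤ ‖A k‖)
    (hA' : ∀ k, d * ‖k‖ ≤ ‖ContinuousLinearMap.adjoint A k‖) : IsUnit A := by
  have hanti : AntilipschitzWith (Real.toNNReal c⁻¹) A := by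
    refine A.antilipschitz_of_bound fun k => ?_
    rw [Real.coe_toNNReal _ (by positivity), inv_mul_eq_div, le_div_iff₀' hc]
    exact hA k
  have hcl : IsClosed (LinearMap.range (A : K →ₗ[ℂ] K) : Set K) :=
    hanti.isClosed_range A.uniformContinuous
  have : CompleteSpace (LinearMap.range (A : K →ₗ[ℂ] K)) := hcl.completeSpace_coe
  rw [ContinuousLinearMap.isUnit_iff_bijective]
  refine ⟨hanti.injective, (LinearMap.range_eq_top (f := (A : K →ₗ[ℂ] K))).mp ?_⟩
  rw [← Submodule.orthogonal_eq_bot_iff, Submodule.eq_bot_iff]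
  intro k hk
  have h0 : ContinuousLinearMap.adjoint A k = 0 := by
    refine ext_inner_left ℂ fun v => ?_
    rw [ContinuousLinearMap.adjoint_inner_right, inner_zero_right]
    exact hk _ ⟨v, rfl⟩
  have := hA' k
  rw [h0, norm_zero] at this
  exact norm_le_zero_iff.mp (nonpos_of_mul_nonpos_right this hd)

/-- Lower bound for `Γ(z)* Γ(w)` when `Γ(z)` and `Γ(w)` parametrize the defect spaces of two points
of the same half-plane. -/
theorem exists_le_norm_adjoint_apply [CompleteSpace K] {T : H →ₗ.[ℂ] H} (hsym : T.IsFormalAdjoint T)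
    (hcl : IsClosed (T.graph : Set (H × H))) {z w : ℂ} (hzw : 0 < z.im * w.im)
    {A B : K →L[ℂ] H} (e : K ≃L[ℂ] (rng T z)ᗮ) (hA : ∀ k, A k = e k)
    (f : K ≃L[ℂ] (rng T w)ᗮ) (hB : ∀ k, B k = f k) :
    ∃ c : ℝ, 0 < c ∧ ∀ k, c * ‖k‖ ≤ ‖ContinuousLinearMap.adjoint A (B k)‖ := by
  obtain ⟨c, hc, hle⟩ := exists_le_norm_add hsym hzw
  have hz : z.im ≠ 0 := left_ne_zero_of_mul hzw.ne'
  have : CompleteSpace (rng T z) := (isClosed_rng hsym hcl hz).completeSpace_coe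
  -- The added `1` keeps the bounds positive even when `K` is trivial.
  set M : ℝ := ‖(e.symm : (rng T z)ᗮ →L[ℂ] K)‖ + 1
  set L : ℝ := ‖(f.symm : (rng T w)ᗮ →L[ℂ] K)‖ + 1
  have hM : 0 < M := by positivity
  have hL : 0 < L := by positivity
  refine ⟨c / (L * M), by positivity, fun k => ?_⟩
  -- the component `g` of `B k` in the defect space of `z`
  obtain ⟨q, hq, g, hg, hsum⟩ := (rng T z).exists_add_mem_mem_orthogonal (B k)
  have hg1 : c * ‖B k‖ ≤ ‖g‖ := by
    have hBk : B k ∈ (rng T w)ᗮ := by rw [hB]; exact (f k).2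
    have := hle (B k) hBk (-q) (Submodule.neg_mem _ hq)
    rwa [hsum, add_neg_cancel_comm, ← hsum] at this
  have hk : ‖k‖ ≤ L * ‖B k‖ := by
    have h1 : ‖f.symm (f k)‖ ≤ ‖(f.symm : (rng T w)ᗮ →L[ℂ] K)‖ * ‖f k‖ :=
      (f.symm : (rng T w)ᗮ →L[ℂ] K).le_opNorm _
    rw [f.symm_apply_apply] at h1
    rw [hB, ← Submodule.coe_norm]
    exact h1.trans (by gcongr; simp [L])
  -- Test vector with `A v = g`, so that `⟨v, A* B k⟩ = ⟨g, B k⟩ = ‖g‖²`.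
  set v : K := e.symm ⟨g, hg⟩
  have hAv : A v = g := by rw [hA, e.apply_symm_apply]
  have hv : ‖v‖ ≤ M * ‖g‖ := by
    have h1 : ‖v‖ ≤ ‖(e.symm : (rng T z)ᗮ →L[ℂ] K)‖ * ‖g‖ :=
      (e.symm : (rng T z)ᗮ →L[ℂ] K).le_opNorm _
    exact h1.trans (by gcongr; simp [M])
  have hin : inner ℂ v (ContinuousLinearMap.adjoint A (B k)) = ((‖g‖ : ℂ)) ^ 2 := by
    rw [ContinuousLinearMap.adjoint_inner_right, hAv, hsum, inner_add_right,
      Submodule.inner_left_of_mem_orthogonal hq hg, zero_add, inner_self_eq_norm_sq_to_K]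
    rfl
  have hgle : ‖g‖ ^ 2 ≤ M * ‖g‖ * ‖ContinuousLinearMap.adjoint A (B k)‖ := by
    have h1 := norm_inner_le_norm (𝕜 := ℂ) v (ContinuousLinearMap.adjoint A (B k))
    rw [hin, norm_pow, Complex.norm_real, norm_norm] at h1
    exact h1.trans (by gcongr)
  have hg2 : ‖g‖ ≤ M * ‖ContinuousLinearMap.adjoint A (B k)‖ := by
    rcases (norm_nonneg g).eq_or_lt with h0 | hpos
    · rw [← h0]
      positivity
    · refine le_of_mul_le_mul_left ?_ hpos
      linarith
  rw [div_mul_eq_mul_div, div_le_iff₀ (by positivity)]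
  calc c * ‖k‖ ≤ c * (L * ‖B k‖) := by gcongr
    _ = L * (c * ‖B k‖) := by ring
    _ ≤ L * (M * ‖ContinuousLinearMap.adjoint A (B k)‖) := by exact mul_le_mul_of_nonneg_left (hg1.trans hg2) hL.le
    _ = _ := by ring

variable {T S : H →ₗ.[ℂ] H}

theorem exists_isKreinMap (hS : IsSelfAdjointExtension T S)
    (j : K ≃L[ℂ] (rng T (-Complex.I))ᗮ) : ∃ Γ : ℂ → K →L[ℂ] H, IsKreinMap S j Γ := by
  refine ⟨fun w => transfer S (conj w) Complex.I ∘L (rng T (-Complex.I))ᗮ.subtypeL ∘L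
    (j : K →L[ℂ] (rng T (-Complex.I))ᗮ), fun w hw k => ?_⟩
  have hw' : (conj w).im ≠ 0 := by simpa using hw
  obtain ⟨x, hx, -⟩ := resolvent_spec hS.2 hw' (j k : H)
  refine ⟨x, hx, ?_⟩
  change transfer S (conj w) Complex.I (j k : H) = _
  rw [← hx, transfer_apply_eq hS.2 hw']

theorem IsKreinMap.apply_eq_transfer (hS : IsSelfAdjointExtension T S)
    {j : K ≃L[ℂ] (rng T (-Complex.I))ᗮ} {Γ : ℂ → K →L[ℂ] H} (hΓ : IsKreinMap S j Γ)
    {w : ℂ} (hw : w.im ≠ 0) (k : K) : Γ w k = transfer S (conj w) Complex.I (j k : H) := by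
  obtain ⟨x, hx, hΓx⟩ := hΓ w hw k
  rw [hΓx, ← hx, transfer_apply_eq hS.2 (by simpa using hw)]

theorem IsKreinMap.exists_equiv (hS : IsSelfAdjointExtension T S)
    {j : K ≃L[ℂ] (rng T (-Complex.I))ᗮ} {Γ : ℂ → K →L[ℂ] H} (hΓ : IsKreinMap S j Γ)
    {w : ℂ} (hw : w.im ≠ 0) : ∃ e : K ≃L[ℂ] (rng T w)ᗮ, ∀ k : K, Γ w k = (e k : H) := by
  have hw' : (conj w).im ≠ 0 := by simpa using hw
  have hI : Complex.I.im ≠ 0 := by simp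
  have hto : ∀ f : (rng T (-Complex.I))ᗮ, transfer S (conj w) Complex.I (f : H) ∈ (rng T w)ᗮ := by
    intro f
    have hf : (f : H) ∈ (rng T (conj Complex.I))ᗮ := by rw [Complex.conj_I]; exact f.2
    simpa using transfer_mem hS.1 hS.2 hw' hf
  have hfrom : ∀ f : (rng T w)ᗮ,
      transfer S Complex.I (conj w) (f : H) ∈ (rng T (-Complex.I))ᗮ := by
    intro f
    have hf : (f : H) ∈ (rng T (conj (conj w)))ᗮ := by rw [Complex.conj_conj]; exact f.2
    simpa using transfer_mem hS.1 hS.2 hI hf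
  let u : (rng T (-Complex.I))ᗮ ≃L[ℂ] (rng T w)ᗮ :=
    ContinuousLinearEquiv.equivOfInverse
      ((transfer S (conj w) Complex.I ∘L (rng T (-Complex.I))ᗮ.subtypeL).codRestrict _ hto)
      ((transfer S Complex.I (conj w) ∘L (rng T w)ᗮ.subtypeL).codRestrict _ hfrom)
      (fun f => Subtype.ext (transfer_transfer hS.2 hw' hI (f : H)))
      (fun f => Subtype.ext (transfer_transfer hS.2 hI hw' (f : H)))
  exact ⟨j.trans u, fun k => hΓ.apply_eq_transfer hS hw k⟩

theorem IsKreinMap.isModel [CompleteSpace K] {n : ℕ∞} (hT : IsSimpleSymmetric n T)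
    (hS : IsSelfAdjointExtension T S)   {j : K ≃L[ℂ] (rng T (-Complex.I))ᗮ} {Γ : ℂ → K →L[ℂ] H} (hΓ : IsKreinMap S j Γ) :
    IsModel T Γ where
  coanalytic := by
    have hopen : IsOpen {a : ℂ | a.im ≠ 0} :=
      isOpen_ne_fun Complex.continuous_im continuous_const
    let J : K →L[ℂ] H := (rng T (-Complex.I))ᗮ.subtypeL ∘L (j : K →L[ℂ] (rng T (-Complex.I))ᗮ)
    have h : AnalyticOnNhd ℂ (fun a => transfer S a Complex.I ∘L J) {a : ℂ | a.im ≠ 0} := by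
      refine DifferentiableOn.analyticOnNhd ?_ hopen
      exact (analyticOnNhd_transfer hS.2 (by simp)).differentiableOn.clm_comp
        (differentiableOn_const J)
    refine h.congr hopen fun z hz => ContinuousLinearMap.ext fun k => ?_
    have hz' : (conj z).im ≠ 0 := by simpa using hz
    change _ = Γ (conj z) k
    rw [hΓ.apply_eq_transfer hS hz', Complex.conj_conj]
    rfl
  invertible := fun _ hw => hΓ.exists_equiv hS hw
  kernel_invertible := by
    intro z w hzw
    have hpos : 0 < z.im * w.im :=
      hzw.elim (fun h => mul_pos h.1 h.2) (fun h => mul_pos_of_neg_of_neg h.1 h.2)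
    obtain ⟨e, he⟩ := hΓ.exists_equiv hS (left_ne_zero_of_mul hpos.ne')
    obtain ⟨f, hf⟩ := hΓ.exists_equiv hS (right_ne_zero_of_mul hpos.ne')
    obtain ⟨c, hc, hc'⟩ := exists_le_norm_adjoint_apply hT.symmetric hT.closed hpos e he f hf
    obtain ⟨d, hd, hd'⟩ := exists_le_norm_adjoint_apply hT.symmetric hT.closed
      (mul_comm z.im w.im ▸ hpos) f hf e he
    refine isUnit_of_bounded_below hc hd hc' ?_
    rw [ContinuousLinearMap.adjoint_comp, ContinuousLinearMap.adjoint_adjoint]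
    exact hd'
  span_eq_top := by
    -- A vector orthogonal to every `Rng Γ(w) = Rng (T - w)ᗮ` lies in every closed `Rng (T - w)`,
    -- hence vanishes by simplicity.
    rw [Submodule.topologicalClosure_eq_top_iff, ← le_bot_iff, ← hT.simple]
    refine le_iInf fun w h hh => ?_
    have hcl := isClosed_rng hT.symmetric hT.closed w.2
    have : CompleteSpace (rng T w) := hcl.completeSpace_coe
    rw [← Submodule.orthogonal_orthogonal (rng T w)]
    intro g hg
    obtain ⟨e, he⟩ := hΓ.exists_equiv hS w.2
    refine hh g (Submodule.mem_iSup_of_mem w ⟨e.symm ⟨g, hg⟩, ?_⟩)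
    change Γ w _ = g
    rw [he, e.apply_symm_apply]

end Model

end SymmetricOperator

theorem mainTheorem8
    {H : Type*} [NormedAddCommGroup H] [InnerProductSpace ℂ H] [CompleteSpace H]
    [TopologicalSpace.SeparableSpace H]
    {K : Type*} [NormedAddCommGroup K] [InnerProductSpace ℂ K] [CompleteSpace K]
    [TopologicalSpace.SeparableSpace K]
    (n : ℕ∞) (T : H →ₗ.[ℂ] H) (hT : SymmetricOperator.IsSimpleSymmetric n T)
    (hK : SymmetricOperator.HasHilbertDim K n) :
    (∃ Γ : ℂ → K →L[ℂ] H, SymmetricOperator.IsModel T Γ) ∧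
    (∃ T' : H →ₗ.[ℂ] H, SymmetricOperator.IsSelfAdjointExtension T T') ∧
    Nonempty (K ≃L[ℂ] (SymmetricOperator.rng T (-Complex.I))ᗮ) ∧
    (∀ T' : H →ₗ.[ℂ] H, SymmetricOperator.IsSelfAdjointExtension T T' →
      ∀ j : K ≃L[ℂ] (SymmetricOperator.rng T (-Complex.I))ᗮ,
        (∃ Γ : ℂ → K →L[ℂ] H, SymmetricOperator.IsKreinMap T' j Γ) ∧
        ∀ Γ : ℂ → K →L[ℂ] H, SymmetricOperator.IsKreinMap T' j Γ →
          SymmetricOperator.IsModel T Γ) := by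
  have hsym : T.IsFormalAdjoint T := hT.symmetric
  obtain ⟨W⟩ := hT.deficiency_plus.nonempty_linearIsometryEquiv hT.deficiency_minus
  obtain ⟨S, hS⟩ := SymmetricOperator.exists_isSelfAdjointExtension hT.dense hsym hT.closed W
  obtain ⟨J⟩ := hK.nonempty_linearIsometryEquiv hT.deficiency_plus
  obtain ⟨Γ, hΓ⟩ := SymmetricOperator.exists_isKreinMap hS J.toContinuousLinearEquiv
  exact ⟨⟨Γ, hΓ.isModel hT hS⟩, ⟨S, hS⟩, ⟨J.toContinuousLinearEquiv⟩, fun T' hT' j =>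
    ⟨SymmetricOperator.exists_isKreinMap hT' j, fun _ h => h.isModel hT hT'⟩⟩
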